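/- Let $q=p^e$ be a prime power with $p$ prime and $e\geq 1$, let $G=\mathbb{Z}/(q^2+q+1)\mathbb{Z}$, let $\alpha$ be a generator of the multiplicative group $\mathbb{F}_{q^3}^\times$, and let $$S=\{\, l\in\{0,\dots,q^2+q\} : \mathrm{Tr}_{\mathbb{F}_{q^3}/\mathbb{F}_q}(\alpha^l)=0 \,\}\subseteq G .$$ Let $\lambda:G\to G$, $\lambda(x)=qx$; it is an automorphism with $\lambda^3=\mathrm{id}$ which preserves $S$. For $s\in S$ let $o(s)=\{s,\lambda(s),\lambda^2(s)\}$, and let $O$ be the set of orbits of $\lambda$ on $S$ which have length $3$. Let $\kappa:O\to\{\pm1\}$ be any map and let $$T=\{(x,x+s,x+s+\lambda(s)) : x\in G,\ s\in S,\ o(s)\notin O\}\cup\{(x,x+s,x+s+\lambda^{\kappa(o(s))}(s)) : x\in G,\ s\in S,\ o(s)\in O\}.$$ Let $\Gamma=\langle a_l,\ l\in G \mid a_ia_ja_k,\ (i,j,k)\in T\rangle$, and let $\Delta$ be the associated triangle complex (the universal cover of the complex with one vertex, one edge for each generator, and triangles glued along the labels $(i,j,k)\in T$): its vertices are the elements of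 $\Gamma$, its edges are the sets $\{g,ga_l\}$ with $g\in\Gamma$, $l\in G$, and its triangles are the sets $\{g,ga_i,ga_ia_j\}$ with $g\in\Gamma$, $(i,j,k)\in T$. Let $v_0=1$ and $v_1=a_0^{-1}$, which are adjacent vertices of $\Delta$. For $i\in\{0,1\}$ let $\Pi_i$ be the link of $v_i$ in $\Delta$, a graph that has $v_{1-i}$ as a vertex. Let $\Lambda$ be the set of the vertices common to $\Pi_0$ and $\Pi_1$. Let $H_i$ be the stabiliser of $v_{1-i}$ in the group $\mathrm{Aut}(\Pi_i)$ of all graph automorphisms of $\Pi_i$, and let $Q_i\leq\mathrm{Sym}(\Lambda)$ be the group of permutations that $H_i$ induces on $\Lambda$. Let $K$ be a field with a discrete valuation $\nu$, with valuation ring $\mathcal{O}_K$ and uniformizer $\pi$. Let $\widetilde{\mathrm{A}_2}(K,\nu)$ be the Bruhat–Tits building of $(K,\nu)$, that is, the flag complex whose vertices are the classes, up to multiplication by scalars in $K^\times$, of the $\mathcal{O}_K$-lattices in $K^3$ (the $\mathcal{O}_K$-submodules generated by a basis of $K^3$), two classes being incident when they have representatives $L$, $L'$ with $\pi L\subseteq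 L'\subseteq L$. If $\Delta$ is isomorphic, as a simplicial complex, to $\widetilde{\mathrm{A}_2}(K,\nu)$, then $Q_1=Q_0$. -/

import Mathlib

namespace SimplicialCx

/-- Two abstract simplicial complexes are isomorphic if there is a bijection between their
vertices that carries the simplices of the first exactly to the simplices of the second. -/
def Isomorphic {V W : Type*} (X : AbstractSimplicialComplex V) (Y : AbstractSimplicialComplex W) :
    Prop :=
  ∃ f : V ≃ W, ∀ s : Finset V, s ∈ X.faces ↔ s.map f.toEmbedding ∈ Y.faces

/-- The vertices of the link of `v`: the vertices other than `v` that lie in a common simplex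
with `v`. -/
def linkVertices {V : Type*} (X : AbstractSimplicialComplex V) (v : V) : Set V :=
  {u | u ≠ v ∧ ∃ s ∈ X.faces, v ∈ s ∧ u ∈ s}

/-- The link of `v` in a complex of dimension at most `2`, as a graph: two distinct vertices
`u`, `w` of the link are joined when `v`, `u`, `w` lie in a common simplex. -/
def link {V : Type*} (X : AbstractSimplicialComplex V) (v : V) :
    SimpleGraph (linkVertices X v) where
  Adj u w := u ≠ w ∧ ∃ s ∈ X.faces, v ∈ s ∧ (u : V) ∈ s ∧ (w : V) ∈ s
  symm := ⟨by
    rintro u w ⟨h, s, hs, hv, hu, hw⟩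
    exact ⟨h.symm, s, hs, hv, hw, hu⟩⟩
  loopless := ⟨fun _ h => h.1 rfl⟩

/-- The vertices that the links of `v` and `w` have in common. -/
def commonLink {V : Type*} (X : AbstractSimplicialComplex V) (v w : V) : Set V :=
  linkVertices X v ∩ linkVertices X w

/-- The stabiliser, in the full automorphism group of the link of `v`, of a vertex `w` of that
link. -/
def linkStabilizer {V : Type*} (X : AbstractSimplicialComplex V) (v : V)
    (w : linkVertices X v) : Subgroup (link X v ≃g link X v) :=
  MulAction.stabilizer (link X v ≃g link X v) w

/-- The permutations that the stabiliser of `w` in the automorphism group of the link of `v`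
induces on a set `M` of vertices of that link: those permutations of `M` that are the
restriction to `M` of an element of the stabiliser. -/
def inducedGroup {V : Type*} (X : AbstractSimplicialComplex V) (v : V) (w : linkVertices X v)
    (M : Set V) (hM : M ⊆ linkVertices X v) : Subgroup (Equiv.Perm M) where
  carrier := {σ | ∃ h ∈ linkStabilizer X v w,
    ∀ x : M, (h ⟨(x : V), hM x.2⟩ : V) = (σ x : V)}
  one_mem' := ⟨1, one_mem _, fun _ => rfl⟩
  mul_mem' := by
    rintro σ τ ⟨h, hh, hσ⟩ ⟨k, hk, hτ⟩
    refine ⟨h * k, mul_mem hh hk, fun x => ?_⟩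
    have e : k ⟨(x : V), hM x.2⟩ = ⟨(τ x : V), hM (τ x).2⟩ := Subtype.ext (hτ x)
    rw [RelIso.mul_apply, e, hσ (τ x), Equiv.Perm.mul_apply]
  inv_mem' := by
    rintro σ ⟨h, hh, hσ⟩
    refine ⟨h⁻¹, inv_mem hh, fun x => ?_⟩
    have e : h ⟨((σ⁻¹ x : M) : V), hM (σ⁻¹ x).2⟩ = ⟨(x : V), hM x.2⟩ :=
      Subtype.ext ((hσ (σ⁻¹ x)).trans (by simp))
    rw [← e, RelIso.inv_apply_self]

end SimplicialCx

namespace TriPres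

/-- The relators `a_i a_j a_k`, for `(i, j, k) ∈ T`. -/
def relators {I : Type*} (T : Set (I × I × I)) : Set (FreeGroup I) :=
  {r | ∃ i j k, (i, j, k) ∈ T ∧ r = FreeGroup.of i * FreeGroup.of j * FreeGroup.of k}

/-- The group `⟨a_l, l ∈ I ∣ a_i a_j a_k, (i, j, k) ∈ T⟩`. -/
abbrev Gam {I : Type*} (T : Set (I × I × I)) : Type _ := PresentedGroup (relators T)

/-- The generator `a_l`. -/
def gen {I : Type*} (T : Set (I × I × I)) (l : I) : Gam T := PresentedGroup.of l

/-- The triangle complex on which the presented group acts: the universal cover of the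
presentation complex made of one vertex, one edge for each generator, and triangles with sides
labelled `i, j, k` for `(i, j, k) ∈ T`. Its vertices are the elements of the group, its edges are
the edges `{g, g a_l}` of the Cayley graph, and its triangles are the sets
`{g, g a_i, g a_i a_j}` with `(i, j, k) ∈ T`. The simplices are the nonempty finite sets that are
contained in a vertex, an edge or a triangle. -/
def complex {I : Type*} (T : Set (I × I × I)) : AbstractSimplicialComplex (Gam T) where
  faces := {s | s.Nonempty ∧
    ((∃ g : Gam T, (s : Set (Gam T)) ⊆ {g}) ∨
     (∃ (g : Gam T) (l : I), (s : Set (Gam T)) ⊆ {g, g * gen T l}) ∨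
     (∃ (g : Gam T) (i j k : I), (i, j, k) ∈ T ∧
        (s : Set (Gam T)) ⊆ {g, g * gen T i, g * gen T i * gen T j}))}
  isRelLowerSet_faces := by
    rintro s ⟨hs, h⟩
    refine ⟨hs, fun t hts ht => ⟨ht, ?_⟩⟩
    have hts' : (t : Set (Gam T)) ⊆ s := Finset.coe_subset.2 hts
    rcases h with ⟨g, h⟩ | ⟨g, l, h⟩ | ⟨g, i, j, k, hT, h⟩
    · exact Or.inl ⟨g, hts'.trans h⟩
    · exact Or.inr (Or.inl ⟨g, l, hts'.trans h⟩)
    · exact Or.inr (Or.inr ⟨g, i, j, k, hT, hts'.trans h⟩)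
  singleton_mem v := ⟨Finset.singleton_nonempty v, Or.inl ⟨v, by simp⟩⟩

/-- Every generator is nontrivial, because all of them map to `1` in `ℤ/3`. -/
theorem gen_ne_one {I : Type*} (T : Set (I × I × I)) (l : I) : gen T l ≠ 1 := by
  intro h
  have hr : ∀ r ∈ relators T,
      FreeGroup.lift (fun _ : I => Multiplicative.ofAdd (1 : ZMod 3)) r = 1 := by
    rintro r ⟨i, j, k, -, rfl⟩
    simp only [map_mul, FreeGroup.lift_apply_of]
    decide
  have h3 : PresentedGroup.toGroup hr (gen T l) = Multiplicative.ofAdd (1 : ZMod 3) :=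
    PresentedGroup.toGroup.of hr
  have h2 := h3.symm.trans ((congrArg (PresentedGroup.toGroup hr) h).trans (map_one _))
  exact absurd h2 (by decide)

open Classical in
theorem inv_gen_mem_link {I : Type*} (T : Set (I × I × I)) (l : I) :
    (gen T l)⁻¹ ∈ SimplicialCx.linkVertices (complex T) 1 :=
  ⟨inv_ne_one.2 (gen_ne_one T l), {(gen T l)⁻¹, 1},
    ⟨⟨1, by simp⟩, Or.inr (Or.inl ⟨(gen T l)⁻¹, l, by simp⟩)⟩, by simp, by simp⟩

open Classical in
theorem one_mem_link {I : Type*} (T : Set (I × I × I)) (l : I) :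
    (1 : Gam T) ∈ SimplicialCx.linkVertices (complex T) (gen T l)⁻¹ :=
  ⟨(inv_ne_one.2 (gen_ne_one T l)).symm, {(gen T l)⁻¹, 1},
    ⟨⟨1, by simp⟩, Or.inr (Or.inl ⟨(gen T l)⁻¹, l, by simp⟩)⟩, by simp, by simp⟩

/-- The common part of the links of the adjacent vertices `1` and `a_l⁻¹`. -/
abbrev Lam {I : Type*} (T : Set (I × I × I)) (l : I) : Set (Gam T) :=
  SimplicialCx.commonLink (complex T) 1 (gen T l)⁻¹

/-- The local permutation group at `v₀ = 1`: the image in `Sym(Λ)` of the stabiliser of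
`v₁ = a_l⁻¹` in the automorphism group of the link of `v₀`. -/
def Q₀ {I : Type*} (T : Set (I × I × I)) (l : I) : Subgroup (Equiv.Perm (Lam T l)) :=
  SimplicialCx.inducedGroup (complex T) 1 ⟨(gen T l)⁻¹, inv_gen_mem_link T l⟩ (Lam T l)
    (fun _ h => h.1)

/-- The local permutation group at `v₁ = a_l⁻¹`: the image in `Sym(Λ)` of the stabiliser of
`v₀ = 1` in the automorphism group of the link of `v₁`. -/
def Q₁ {I : Type*} (T : Set (I × I × I)) (l : I) : Subgroup (Equiv.Perm (Lam T l)) :=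
  SimplicialCx.inducedGroup (complex T) (gen T l)⁻¹ ⟨1, one_mem_link T l⟩ (Lam T l)
    (fun _ h => h.2)

end TriPres

namespace SingerPres

/-- The set `S` of those `l ∈ {0, …, q² + q}` for which `α ^ l` has trace zero, as a subset of
`ℤ/(q² + q + 1)ℤ`. -/
def traceZeroSet (F : Type*) {E : Type*} [Field F] [Field E] [Algebra F E] (q : ℕ) (α : E) :
    Set (ZMod (q ^ 2 + q + 1)) :=
  {l | Algebra.trace F E (α ^ l.val) = 0}

theorem cube_eq_one (q : ℕ) : (q : ZMod (q ^ 2 + q + 1)) ^ 3 = 1 := by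
  have h : ((q ^ 2 + q + 1 : ℕ) : ZMod (q ^ 2 + q + 1)) = 0 := ZMod.natCast_self _
  push_cast at h
  linear_combination ((q : ZMod (q ^ 2 + q + 1)) - 1) * h

/-- The permutation `x ↦ q x` of `ℤ/(q² + q + 1)ℤ`; its inverse is `x ↦ q² x`. -/
def lam (q : ℕ) : Equiv.Perm (ZMod (q ^ 2 + q + 1)) where
  toFun x := q * x
  invFun x := q ^ 2 * x
  left_inv x := by linear_combination x * cube_eq_one q
  right_inv x := by linear_combination x * cube_eq_one q

/-- The orbit `{s, λ(s), λ²(s)}` of `s`. -/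
def orb (q : ℕ) (s : ZMod (q ^ 2 + q + 1)) : Set (ZMod (q ^ 2 + q + 1)) :=
  {s, lam q s, lam q (lam q s)}

/-- The set `O` of the orbits of length `3` of `λ` on `S`. -/
def longOrbits (q : ℕ) (S : Set (ZMod (q ^ 2 + q + 1))) : Set (Set (ZMod (q ^ 2 + q + 1))) :=
  {A | ∃ s ∈ S, A = orb q s ∧ A.ncard = 3}

/-- The set `T_κ` of the triples `(x, x + s, x + s + λ(s))` with `s ∈ S`, `o(s) ∉ O`, and
`(x, x + s, x + s + λ^{κ(o(s))}(s))` with `s ∈ S`, `o(s) ∈ O`. -/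
def presentation (q : ℕ) (S : Set (ZMod (q ^ 2 + q + 1))) (κ : longOrbits q S → ℤˣ) :
    Set (ZMod (q ^ 2 + q + 1) × ZMod (q ^ 2 + q + 1) × ZMod (q ^ 2 + q + 1)) :=
  {t | ∃ x, ∃ s ∈ S, orb q s ∉ longOrbits q S ∧ t = (x, x + s, x + s + lam q s)} ∪
  {t | ∃ x, ∃ s ∈ S, ∃ h : orb q s ∈ longOrbits q S,
    t = (x, x + s, x + s + (lam q ^ ((κ ⟨orb q s, h⟩ : ℤˣ) : ℤ)) s)}

end SingerPres

namespace BruhatTits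

open scoped Pointwise

/-- The lattices in `K³` over the valuation ring of `ν`: the submodules generated by a basis
of `K³`. -/
abbrev Lattice {K Γ₀ : Type*} [Field K] [LinearOrderedCommGroupWithZero Γ₀] (ν : Valuation K Γ₀) :
    Type _ :=
  {L : Submodule ν.integer (Fin 3 → K) // ∃ b : Module.Basis (Fin 3) K (Fin 3 → K),
    L = Submodule.span ν.integer (Set.range b)}

/-- Two lattices are equivalent if one is a multiple of the other by a nonzero scalar. -/
def homothety {K Γ₀ : Type*} [Field K] [LinearOrderedCommGroupWithZero Γ₀]
    (ν : Valuation K Γ₀) : Setoid (Lattice ν) where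
  r L M := ∃ c : K, c ≠ 0 ∧ M.1 = c • L.1
  iseqv :=
    { refl := fun L => ⟨1, one_ne_zero, (one_smul _ _).symm⟩
      symm := by
        rintro L M ⟨c, hc, h⟩
        exact ⟨c⁻¹, inv_ne_zero hc, by rw [h, smul_smul, inv_mul_cancel₀ hc, one_smul]⟩
      trans := by
        rintro L M N ⟨c, hc, h⟩ ⟨d, hd, h'⟩
        exact ⟨d * c, mul_ne_zero hd hc, by rw [h', h, mul_smul]⟩ }

/-- The vertices of the building: the equivalence classes of lattices in `K³`. -/
abbrev Vertex {K Γ₀ : Type*} [Field K] [LinearOrderedCommGroupWithZero Γ₀]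
    (ν : Valuation K Γ₀) : Type _ :=
  Quotient (homothety ν)

/-- Two classes are incident if they have representatives `L`, `L'` with `π L ⊆ L' ⊆ L`, where
`π` is a uniformizer. -/
def Incident {K Γ₀ : Type*} [Field K] [LinearOrderedCommGroupWithZero Γ₀]
    (ν : Valuation K Γ₀) [ν.IsRankOneDiscrete] (x y : Vertex ν) : Prop :=
  ∃ L L' : Lattice ν, Quotient.mk (homothety ν) L = x ∧ Quotient.mk (homothety ν) L' = y ∧
    ∃ π : K, ν.IsUniformizer π ∧ π • L.1 ≤ L'.1 ∧ L'.1 ≤ L.1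

/-- The Bruhat–Tits building of type `Ã₂` of `(K, ν)`: the flag complex of the incidence
relation between equivalence classes of lattices in `K³`. -/
def building {K Γ₀ : Type*} [Field K] [LinearOrderedCommGroupWithZero Γ₀]
    (ν : Valuation K Γ₀) [ν.IsRankOneDiscrete] : AbstractSimplicialComplex (Vertex ν) where
  faces := {s | s.Nonempty ∧ ∀ x ∈ s, ∀ y ∈ s, x ≠ y → Incident ν x y}
  isRelLowerSet_faces := by
    rintro s ⟨hs, h⟩
    exact ⟨hs, fun t hts ht => ⟨ht, fun x hx y hy => h x (hts hx) y (hts hy)⟩⟩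
  singleton_mem v := by
    refine ⟨Finset.singleton_nonempty v, fun x hx y hy hxy => ?_⟩
    rw [Finset.mem_singleton] at hx hy
    exact absurd (hx.trans hy.symm) hxy

end BruhatTits

/-!
For two adjacent vertices `x`, `y` of the building there is an automorphism of the building that
swaps `x` and `y` and fixes every common neighbour of `x` and `y` (`BruhatTits.exists_swap`).
Transported to a complex isomorphic to the building, conjugation by it carries the stabiliser of
`w` in the link of `v` to the stabiliser of `v` in the link of `w` without changing the action on
the common part of the two links, so the two induced groups coincide
(`SimplicialCx.inducedGroup_eq_of_swap`). Only the isomorphism with the building matters for this;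
the shape of the presentation plays no role.

The automorphism is a polarity. A nondegenerate bilinear form on `K³` sends a lattice to its dual
lattice; this reverses inclusions and respects homothety, so it permutes the vertices of the
building and preserves incidence. By the elementary divisor theorem (`exists_isAdapted`), `x` and
`y` are, in one of the two orders, the classes of `L = ⟨e₀, e₁, e₂⟩` and `M = ⟨e₀, e₁, π e₂⟩`. For
the form `x₀ y₁ - x₁ y₀ + π⁻¹ x₂ y₂`, the duals of `L` and `M` are `M` and `L`. The common
neighbours are the classes of the lattices `Z` with `π L ⊂ Z ⊂ M` (`IsAdapted.exists_between`),
which correspond to the lines of the plane `M / π L` over the residue field. As the form is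
alternating on that plane, each line is its own orthogonal, and the dual of `Z` is `π⁻¹ Z`
(`IsAdapted.dual_of_between`).
-/

/-! ### Automorphisms of a complex and the groups induced on links -/

namespace SimplicialCx

/-- An automorphism `τ` of a simplicial complex maps the link of `v` isomorphically onto the link
of `w = τ v`. -/
def linkIso {V : Type*} (X : AbstractSimplicialComplex V) (τ : Equiv.Perm V)
    (hτ : ∀ s : Finset V, s ∈ X.faces ↔ s.map τ.toEmbedding ∈ X.faces) {v w : V} (h : τ v = w) :
    link X v ≃g link X w where
  toEquiv := τ.subtypeEquiv fun u => by
    subst h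
    refine and_congr τ.injective.ne_iff.symm ⟨?_, ?_⟩
    · rintro ⟨s, hs, hv, hu⟩
      exact ⟨s.map τ.toEmbedding, (hτ s).1 hs, Finset.mem_map_of_mem _ hv,
        Finset.mem_map_of_mem _ hu⟩
    · rintro ⟨s, hs, hv, hu⟩
      have e : (s.map τ.symm.toEmbedding).map τ.toEmbedding = s := by
        simp [Finset.map_map]
      exact ⟨s.map τ.symm.toEmbedding, (hτ _).2 (e.symm ▸ hs), by simpa using hv, by simpa using hu⟩
  map_rel_iff' := by
    subst h
    intro a b
    refine and_congr (Equiv.injective _).ne_iff ⟨?_, ?_⟩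
    · rintro ⟨s, hs, hv, ha, hb⟩
      have e : (s.map τ.symm.toEmbedding).map τ.toEmbedding = s := by
        simp [Finset.map_map]
      refine ⟨s.map τ.symm.toEmbedding, (hτ _).2 (e.symm ▸ hs), by simpa using hv, ?_, ?_⟩
      · simpa using ha
      · simpa using hb
    · rintro ⟨s, hs, hv, ha, hb⟩
      exact ⟨s.map τ.toEmbedding, (hτ s).1 hs, Finset.mem_map_of_mem _ hv,
        Finset.mem_map_of_mem _ ha, Finset.mem_map_of_mem _ hb⟩

@[simp]
theorem coe_linkIso_apply {V : Type*} (X : AbstractSimplicialComplex V) (τ : Equiv.Perm V)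
    (hτ : ∀ s : Finset V, s ∈ X.faces ↔ s.map τ.toEmbedding ∈ X.faces) {v w : V} (h : τ v = w)
    (u : linkVertices X v) : (linkIso X τ hτ h u : V) = τ u :=
  rfl

/-- Conjugation by an automorphism that swaps `v` and `w` and fixes the set `M` pointwise carries
the stabiliser of `w` in the link of `v` into that of `v` in the link of `w`, without changing the
induced permutations of `M`. -/
theorem inducedGroup_le_of_swap {V : Type*} (X : AbstractSimplicialComplex V) (τ : Equiv.Perm V)
    (hτ : ∀ s : Finset V, s ∈ X.faces ↔ s.map τ.toEmbedding ∈ X.faces)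
    {v w : V} (hv : τ v = w) (hw : τ w = v) (hwv : w ∈ linkVertices X v)
    (hvw : v ∈ linkVertices X w) (M : Set V) (hMv : M ⊆ linkVertices X v)
    (hMw : M ⊆ linkVertices X w) (hM : ∀ x ∈ M, τ x = x) :
    inducedGroup X v ⟨w, hwv⟩ M hMv ≤ inducedGroup X w ⟨v, hvw⟩ M hMw := by
  rintro σ ⟨h, hh, hσ⟩
  set φ := linkIso X τ hτ hv
  have key : ∀ (u : linkVertices X v) (u' : linkVertices X w), τ u = u' → φ.symm u' = u := by
    intro u u' e
    rw [RelIso.symm_apply_eq]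
    exact Subtype.ext e.symm
  refine ⟨(φ.symm.trans h).trans φ, ?_, fun x => ?_⟩
  · change φ (h (φ.symm _)) = _
    rw [key ⟨w, hwv⟩ ⟨v, hvw⟩ hw, show h ⟨w, hwv⟩ = ⟨w, hwv⟩ from hh]
    exact Subtype.ext hw
  · change (φ (h (φ.symm _)) : V) = _
    rw [key ⟨x, hMv x.2⟩ ⟨x, hMw x.2⟩ (hM x x.2)]
    change τ (h _ : V) = _
    rw [hσ, hM _ (σ x).2]

theorem inducedGroup_eq_of_swap {V : Type*} (X : AbstractSimplicialComplex V) (τ : Equiv.Perm V)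
    (hτ : ∀ s : Finset V, s ∈ X.faces ↔ s.map τ.toEmbedding ∈ X.faces)
    {v w : V} (hv : τ v = w) (hw : τ w = v) (hwv : w ∈ linkVertices X v)
    (hvw : v ∈ linkVertices X w) (M : Set V) (hMv : M ⊆ linkVertices X v)
    (hMw : M ⊆ linkVertices X w) (hM : ∀ x ∈ M, τ x = x) :
    inducedGroup X v ⟨w, hwv⟩ M hMv = inducedGroup X w ⟨v, hvw⟩ M hMw :=
  le_antisymm (inducedGroup_le_of_swap X τ hτ hv hw hwv hvw M hMv hMw hM)
    (inducedGroup_le_of_swap X τ hτ hw hv hvw hwv M hMw hMv hM)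

end SimplicialCx

/-! ### Homothety, duality and incidence of lattices -/

namespace BruhatTits

open scoped Pointwise
open LinearMap (BilinForm)

section

variable {K Γ₀ : Type*} [Field K] [LinearOrderedCommGroupWithZero Γ₀] {ν : Valuation K Γ₀}

theorem mem_smul_iff {c : K} (hc : c ≠ 0) (L : Submodule ν.integer (Fin 3 → K)) (x : Fin 3 → K) :
    x ∈ c • L ↔ c⁻¹ • x ∈ L := by
  constructor
  · rintro ⟨y, hy, rfl⟩
    simpa [smul_smul, hc] using hy
  · intro h
    exact ⟨_, h, by simp [smul_smul, hc]⟩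

theorem smul_mem_of_le_one {a : K} (ha : ν a ≤ 1) (L : Submodule ν.integer (Fin 3 → K))
    {x : Fin 3 → K} (hx : x ∈ L) : a • x ∈ L :=
  L.smul_mem (⟨a, ha⟩ : ν.integer) hx

theorem smul_le_smul_of_le {a b : K} (hb : b ≠ 0) (h : ν a ≤ ν b)
    (L : Submodule ν.integer (Fin 3 → K)) : a • L ≤ b • L := by
  rintro _ ⟨x, hx, rfl⟩
  rw [mem_smul_iff hb]
  change b⁻¹ • a • x ∈ L
  rw [smul_smul]
  refine smul_mem_of_le_one ?_ L hx
  rw [map_mul, map_inv₀, inv_mul_le_iff₀ (zero_lt_iff.2 (ν.ne_zero_iff.2 hb)), mul_one]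
  exact h

theorem smul_eq_smul_of_eq {a b : K} (ha : a ≠ 0) (h : ν a = ν b)
    (L : Submodule ν.integer (Fin 3 → K)) : a • L = b • L :=
  have hb : b ≠ 0 := ν.ne_zero_iff.1 (h ▸ ν.ne_zero_iff.2 ha)
  le_antisymm (smul_le_smul_of_le hb h.le L) (smul_le_smul_of_le ha h.ge L)

theorem smul_mono (c : K) {L M : Submodule ν.integer (Fin 3 → K)} (h : L ≤ M) :
    c • L ≤ c • M :=
  Submodule.map_mono h

theorem exists_basis_smul {c : K} (hc : c ≠ 0) (L : Lattice ν) :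
    ∃ b : Module.Basis (Fin 3) K (Fin 3 → K), c • L.1 = Submodule.span ν.integer (Set.range b) := by
  obtain ⟨L, b, rfl⟩ := L
  refine ⟨Module.Basis.isUnitSMul b (w := fun _ => c) (fun _ => hc.isUnit), ?_⟩
  have : Set.range (Module.Basis.isUnitSMul b (w := fun _ => c) (fun _ => hc.isUnit)) =
      c • Set.range b := by
    ext x
    simp [Set.mem_smul_set, Module.Basis.isUnitSMul_apply]
  rw [this]
  exact Submodule.smul_span c (Set.range b)

/-- The multiple `c L` of a lattice. -/
def scale {c : K} (hc : c ≠ 0) (L : Lattice ν) : Lattice ν := ⟨c • L.1, exists_basis_smul hc L⟩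

theorem mk_scale {c : K} (hc : c ≠ 0) (L : Lattice ν) :
    Quotient.mk (homothety ν) (scale hc L) = Quotient.mk (homothety ν) L :=
  Quotient.sound ⟨c⁻¹, inv_ne_zero hc, by simp [scale, smul_smul, hc]⟩

/-- The lattice dual to `L` with respect to `B`. -/
noncomputable def dual (B : BilinForm K (Fin 3 → K)) (hB : B.Nondegenerate) (L : Lattice ν) :
    Lattice ν :=
  ⟨B.dualSubmodule L.1, by
    obtain ⟨L, b, rfl⟩ := L
    classical
    exact ⟨_, BilinForm.dualSubmodule_span_of_basis B hB b⟩⟩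

variable (B : BilinForm K (Fin 3 → K)) (hB : B.Nondegenerate)

theorem mem_dual {L : Lattice ν} {x : Fin 3 → K} :
    x ∈ (dual B hB L).1 ↔ ∀ y ∈ L.1, ν (B x y) ≤ 1 := by
  refine forall₂_congr fun y _ => ?_
  rw [Submodule.mem_one]
  exact ⟨fun ⟨r, hr⟩ => hr ▸ r.2, fun h => ⟨⟨_, h⟩, rfl⟩⟩

theorem dual_anti {L M : Lattice ν} (h : L.1 ≤ M.1) : (dual B hB M).1 ≤ (dual B hB L).1 :=
  fun _ hx y hy => hx y (h hy)

theorem dual_eq_of_eq_smul {L M : Lattice ν} {c : K} (hc : c ≠ 0) (h : M.1 = c • L.1) :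
    (dual B hB M).1 = c⁻¹ • (dual B hB L).1 := by
  ext x
  rw [mem_smul_iff (inv_ne_zero hc), mem_dual, mem_dual, inv_inv, h]
  constructor
  · intro H y hy
    simpa using H _ (Submodule.smul_mem_pointwise_smul y c L.1 hy)
  · rintro H _ ⟨y, hy, rfl⟩
    simpa using H y hy

theorem dual_dual_flip (L : Lattice ν) : dual B hB (dual B.flip hB.flip L) = L := by
  obtain ⟨L, b, rfl⟩ := L
  exact Subtype.ext (BilinForm.dualSubmodule_dualSubmodule_flip_of_basis B hB b)

theorem dual_flip_dual (L : Lattice ν) : dual B.flip hB.flip (dual B hB L) = L := by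
  obtain ⟨L, b, rfl⟩ := L
  exact Subtype.ext (BilinForm.dualSubmodule_flip_dualSubmodule_of_basis B hB b)

/-- The map that `L ↦ dual L` induces on homothety classes. -/
noncomputable def dualClass : Vertex ν → Vertex ν :=
  Quotient.map (dual B hB) fun _ _ ⟨c, hc, h⟩ =>
    ⟨c⁻¹, inv_ne_zero hc, dual_eq_of_eq_smul B hB hc h⟩

/-- The permutation of the set of vertices of the building defined by a nondegenerate bilinear
form: the class of a lattice goes to the class of the dual lattice. -/
noncomputable def polarity : Equiv.Perm (Vertex ν) where
  toFun := dualClass B hB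
  invFun := dualClass B.flip hB.flip
  left_inv := by
    rintro ⟨L⟩
    exact congrArg (Quotient.mk _) (dual_flip_dual B hB L)
  right_inv := by
    rintro ⟨L⟩
    exact congrArg (Quotient.mk _) (dual_dual_flip B hB L)

theorem polarity_mk (L : Lattice ν) :
    polarity B hB (Quotient.mk _ L) = Quotient.mk _ (dual B hB L) :=
  rfl

section Discrete

variable [ν.IsRankOneDiscrete]

theorem Incident.symm {x y : Vertex ν} (h : Incident ν x y) : Incident ν y x := by
  obtain ⟨L, M, rfl, rfl, π, hπ, h1, h2⟩ := h
  exact ⟨M, scale hπ.ne_zero L, rfl, mk_scale _ L, π, hπ, smul_mono π h2, h1⟩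

theorem Incident.dualClass {x y : Vertex ν} (h : Incident ν x y) :
    Incident ν (dualClass B hB x) (dualClass B hB y) := by
  obtain ⟨L, M, rfl, rfl, π, hπ, h1, h2⟩ := h
  refine Incident.symm ⟨dual B hB M, dual B hB L, rfl, rfl, π, hπ, ?_, dual_anti B hB h2⟩
  have h3 := dual_anti B hB (L := scale hπ.ne_zero L) (M := M) h1
  rw [dual_eq_of_eq_smul B hB (L := L) (M := scale hπ.ne_zero L) hπ.ne_zero rfl] at h3
  have := smul_mono π h3
  rwa [smul_smul, mul_inv_cancel₀ hπ.ne_zero, one_smul] at this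

theorem incident_polarity_iff {x y : Vertex ν} :
    Incident ν (polarity B hB x) (polarity B hB y) ↔ Incident ν x y := by
  refine ⟨fun h => ?_, Incident.dualClass B hB⟩
  have := Incident.dualClass B.flip hB.flip h
  change Incident ν ((polarity B hB).symm (polarity B hB x))
    ((polarity B hB).symm (polarity B hB y)) at this
  simpa using this

/-- There is no value strictly between that of a uniformizer and `1`. -/
theorem le_of_lt_one {π c : K} (hπ : ν.IsUniformizer π) (hc : ν c < 1) : ν c ≤ ν π := by
  by_cases h0 : c = 0
  · simp [h0]
  have hmem : ν c ∈ Set.range ν \ {0} := ⟨⟨c, rfl⟩, ν.ne_zero_iff.2 h0⟩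
  rw [← Valuation.IsRankOneDiscrete.generator_zpowers_eq_range] at hmem
  obtain ⟨_, ⟨n, rfl⟩, hn⟩ := hmem
  have hg := Valuation.IsRankOneDiscrete.generator_lt_one ν
  rw [hπ.val, ← hn, Units.val_le_val]
  rw [← hn, ← Units.val_one, Units.val_lt_val] at hc
  -- A nonnegative power of the inverse of the generator is at least `1`, so `1 ≤ n`.
  have h1 : (1 : ℤ) ≤ n := by
    by_contra! h
    have := (zpow_right_strictAnti hg).antitone (show n ≤ 0 by omega)
    simp only [zpow_zero] at this
    exact absurd hc (not_lt.2 this)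
  simpa using (zpow_right_strictAnti hg).antitone h1

theorem isPrincipalIdealRing_integer : IsPrincipalIdealRing ν.integer :=
  Valuation.valuationSubring_isPrincipalIdealRing ν

end Discrete
end
end BruhatTits

/-! ### Bases adapted to a pair of lattices -/

namespace BruhatTits

open scoped Pointwise
open LinearMap (BilinForm)

variable {K Γ₀ : Type*} [Field K] [LinearOrderedCommGroupWithZero Γ₀] {ν : Valuation K Γ₀}

theorem mem_span_basis_iff (b : Module.Basis (Fin 3) K (Fin 3 → K)) (x : Fin 3 → K) :
    x ∈ Submodule.span ν.integer (Set.range b) ↔ ∀ i, ν (b.repr x i) ≤ 1 := by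
  rw [b.mem_span_iff_repr_mem ν.integer]
  exact forall_congr' fun i => ⟨fun ⟨r, hr⟩ => hr ▸ r.2, fun h => ⟨⟨_, h⟩, rfl⟩⟩

/-- The elementary divisor theorem for a pair of lattices, in terms of coordinates. -/
theorem exists_diagonal_basis [ν.IsRankOneDiscrete] {L M : Lattice ν} (h : M.1 ≤ L.1) :
    ∃ (e : Module.Basis (Fin 3) K (Fin 3 → K)) (a : Fin 3 → K),
      (∀ x, x ∈ L.1 ↔ ∀ i, ν (e.repr x i) ≤ 1) ∧
      (∀ x, x ∈ M.1 ↔ ∀ i, ν (e.repr x i) ≤ ν (a i)) := by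
  have := isPrincipalIdealRing_integer (ν := ν)
  obtain ⟨L, bL, hL⟩ := L
  obtain ⟨M, bM, hM⟩ := M
  have cL : Module.Basis (Fin 3) ν.integer L := by
    rw [hL]; exact bL.restrictScalars ν.integer
  have cM : Module.Basis (Fin 3) ν.integer M := by
    rw [hM]; exact bM.restrictScalars ν.integer
  change M ≤ L at h
  set N : Submodule ν.integer L := M.submoduleOf L
  have hfin : Module.finrank ν.integer N = Module.finrank ν.integer L := by
    rw [(Submodule.submoduleOfEquivOfLe h).finrank_eq, Module.finrank_eq_card_basis cL,
      Module.finrank_eq_card_basis cM]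
  obtain ⟨b', a, ab', hab⟩ := Submodule.exists_smith_normal_form_of_rank_eq (N := N) cL hfin
  have hLspan : Submodule.span ν.integer (Set.range fun i => (b' i : Fin 3 → K)) = L := by
    have := congrArg (Submodule.map L.subtype) b'.span_eq
    rwa [Submodule.map_span, Submodule.map_subtype_top, ← Set.range_comp] at this
  have hMspan : Submodule.span ν.integer
      (Set.range fun i => ((ab' i : L) : Fin 3 → K)) = M := by
    have := congrArg (Submodule.map (L.subtype ∘ₗ N.subtype)) ab'.span_eq
    rw [Submodule.map_span, Submodule.map_comp, Submodule.map_subtype_top, ← Set.range_comp] at this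
    refine this.trans ?_
    simp only [N, Submodule.submoduleOf, Submodule.map_comap_subtype]
    exact inf_eq_right.2 h
  have htop : ⊤ ≤ Submodule.span K (Set.range fun i => (b' i : Fin 3 → K)) := by
    rw [← bL.span_eq, Submodule.span_le]
    rintro _ ⟨i, rfl⟩
    have : bL i ∈ L := hL ▸ Submodule.subset_span ⟨i, rfl⟩
    rw [← hLspan] at this
    exact Submodule.span_le_restrictScalars ν.integer K _ this
  let e := basisOfTopLeSpanOfCardEqFinrank (fun i => (b' i : Fin 3 → K)) htop (by simp)
  have he : ∀ i, e i = b' i := fun i => by simp [e]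
  have heab : ∀ i, ((ab' i : L) : Fin 3 → K) = (a i : K) • e i := fun i => by
    rw [hab, he]; rfl
  refine ⟨e, fun i => a i, fun x => ?_, fun x => ?_⟩
  · change x ∈ L ↔ _
    rw [← mem_span_basis_iff, ← hLspan]
    simp only [← he]
  · change x ∈ M ↔ _
    rw [← hMspan, Submodule.mem_span_range_iff_exists_fun]
    simp only [heab]
    constructor
    · rintro ⟨c, rfl⟩ i
      have : e.repr (∑ i, c i • (a i : K) • e i) i = c i * a i := by
        have e1 : ∀ i, c i • (a i : K) • e i = ((c i : K) * a i) • e i := fun i => by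
          rw [mul_smul]; rfl
        simp only [e1]
        exact congrFun (e.repr_sum_self _) i
      rw [this, map_mul]
      exact mul_le_of_le_one_left' (c i).2
    · intro hx
      have hc : ∀ i, ν (e.repr x i / a i) ≤ 1 := fun i => by
        rw [map_div₀]
        exact div_le_one_of_le₀ (hx i) zero_le
      refine ⟨fun i => ⟨_, hc i⟩, ?_⟩
      conv_rhs => rw [← e.sum_repr x]
      refine Finset.sum_congr rfl fun i _ => ?_
      change (e.repr x i / (a i : K)) • (a i : K) • e i = _
      rw [smul_smul]
      by_cases h0 : (a i : K) = 0
      · have : e.repr x i = 0 := by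
          have := hx i
          rwa [h0, map_zero, le_zero_iff, ν.zero_iff] at this
        simp [this]
      · rw [div_mul_cancel₀ _ h0]

theorem exists_perm_of_ne {α : Type*} {s t : α} {f : Fin 3 → α} (hf : ∀ i, f i = s ∨ f i = t)
    (hs : ¬ ∀ i, f i = s) (ht : ¬ ∀ i, f i = t) :
    ∃ p : Equiv.Perm (Fin 3), (f (p 0) = s ∧ f (p 1) = s ∧ f (p 2) = t) ∨
      (f (p 0) = t ∧ f (p 1) = t ∧ f (p 2) = s) := by
  simp only [Fin.forall_fin_succ, Fin.forall_fin_zero, Fin.succ_zero_eq_one, Fin.succ_one_eq_two,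
    and_true] at hf hs ht
  have e1 : Equiv.swap (0 : Fin 3) 2 1 = 1 := by decide
  have e2 : Equiv.swap (1 : Fin 3) 2 0 = 0 := by decide
  obtain ⟨h0 | h0, h1 | h1, h2 | h2⟩ := hf
  · exact absurd ⟨h0, h1, h2⟩ hs
  · exact ⟨1, by simp [*]⟩
  · exact ⟨Equiv.swap 1 2, by simp [*]⟩
  · exact ⟨Equiv.swap 0 2, by simp [*]⟩
  · exact ⟨Equiv.swap 0 2, by simp [*]⟩
  · exact ⟨Equiv.swap 1 2, by simp [*]⟩
  · exact ⟨1, by simp [*]⟩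
  · exact absurd ⟨h0, h1, h2⟩ ht

/-- The basis `e` of `K³` is adapted to the pair `M ⊆ L` if `L = ⟨e₀, e₁, e₂⟩` and
`M = ⟨e₀, e₁, π e₂⟩`. -/
structure IsAdapted (π : K) (e : Module.Basis (Fin 3) K (Fin 3 → K)) (L M : Lattice ν) : Prop where
  mem_left : ∀ x, x ∈ L.1 ↔ ν (e.repr x 0) ≤ 1 ∧ ν (e.repr x 1) ≤ 1 ∧ ν (e.repr x 2) ≤ 1
  mem_right : ∀ x, x ∈ M.1 ↔ ν (e.repr x 0) ≤ 1 ∧ ν (e.repr x 1) ≤ 1 ∧ ν (e.repr x 2) ≤ ν π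

theorem forall_fin_three_perm {P : Fin 3 → Prop} (p : Equiv.Perm (Fin 3)) :
    (∀ i, P i) ↔ P (p 0) ∧ P (p 1) ∧ P (p 2) := by
  rw [← p.forall_congr_right]
  simp [Fin.forall_fin_succ]

/-- If `M` lies strictly between `π L` and `L`, there is a basis adapted to `M ⊂ L` or to
`π L ⊂ M`, according to the length of `L / M`. -/
theorem exists_isAdapted [ν.IsRankOneDiscrete] {π : K} (hπ : ν.IsUniformizer π) {L M : Lattice ν}
    (h1 : π • L.1 ≤ M.1) (h2 : M.1 ≤ L.1) (hL : M.1 ≠ L.1) (hπL : M.1 ≠ π • L.1) :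
    ∃ e, IsAdapted π e L M ∨ IsAdapted π e M (scale hπ.ne_zero L) := by
  obtain ⟨e, a, heL, heM⟩ := exists_diagonal_basis h2
  have hπ0 := zero_lt_iff.2 hπ.val_ne_zero
  have hrepr : ∀ (c : K) i j, e.repr (c • e i) j = if i = j then c else 0 := fun c i j => by
    simp [Finsupp.single_apply]
  have heπ : ∀ x, x ∈ π • L.1 ↔ ∀ i, ν (e.repr x i) ≤ ν π := fun x => by
    rw [mem_smul_iff hπ.ne_zero, heL]
    refine forall_congr' fun i => ?_
    simp only [map_smul, Finsupp.smul_apply, smul_eq_mul, map_mul, map_inv₀]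
    rw [inv_mul_le_iff₀ hπ0, mul_one]
  have ha : ∀ i, ν (a i) = 1 ∨ ν (a i) = ν π := fun i => by
    have ha1 : ν (a i) ≤ 1 := by
      have : a i • e i ∈ M.1 := (heM _).2 fun j => by
        rw [hrepr]; split_ifs with hij
        · rw [hij]
        · simp
      simpa using (heL _).1 (h2 this) i
    have haπ : ν π ≤ ν (a i) := by
      have : π • e i ∈ π • L.1 := (heπ _).2 fun j => by
        rw [hrepr]; split_ifs <;> simp
      simpa using (heM _).1 (h1 this) i
    exact ha1.eq_or_lt.imp_right fun h => (le_of_lt_one hπ h).antisymm haπ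
  -- Either two of the three elementary divisors are `1` and one is `π`, or the reverse.
  obtain ⟨p, hp | hp⟩ := exists_perm_of_ne (f := fun i => ν (a i)) ha
    (fun h => hL (by ext x; rw [heL, heM]; simp only [h]))
    (fun h => hπL (by ext x; rw [heπ, heM]; simp only [h]))
  · refine ⟨e.reindex p.symm, Or.inl ⟨fun x => ?_, fun x => ?_⟩⟩
    · rw [heL, forall_fin_three_perm p]; simp
    · rw [heM, forall_fin_three_perm p]; simp [hp]
  · -- If `M = ⟨π e₀, π e₁, e₂⟩`, these three vectors are a basis adapted to `π L ⊂ M`.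
    have hw : ∀ i, IsUnit ((![π, π, 1] : Fin 3 → K) i) := by
      simp [Fin.forall_fin_succ, hπ.ne_zero]
    have hscale : ∀ u : K, ν (π⁻¹ * u) ≤ 1 ↔ ν u ≤ ν π := fun u => by
      rw [map_mul, map_inv₀, inv_mul_le_iff₀ hπ0, mul_one]
    refine ⟨Module.Basis.isUnitSMul (e.reindex p.symm) hw, Or.inr ⟨fun x => ?_, fun x => ?_⟩⟩
    · rw [heM, forall_fin_three_perm p]
      simp only [hp, Module.Basis.repr_isUnitSMul, Units.smul_def, Units.val_inv_eq_inv_val,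
        IsUnit.unit_spec, smul_eq_mul]
      simp [hscale, -map_mul]
    · change x ∈ π • L.1 ↔ _
      rw [heπ, forall_fin_three_perm p]
      simp only [Module.Basis.repr_isUnitSMul, Units.smul_def, Units.val_inv_eq_inv_val,
        IsUnit.unit_spec, smul_eq_mul]
      simp [hscale, -map_mul]

end BruhatTits

/-! ### The polarity that swaps two adjacent vertices -/

namespace BruhatTits

open scoped Pointwise
open LinearMap (BilinForm)

variable {K Γ₀ : Type*} [Field K] [LinearOrderedCommGroupWithZero Γ₀] {ν : Valuation K Γ₀}

/-- The bilinear form `x₀ y₁ - x₁ y₀ + π⁻¹ x₂ y₂` in the coordinates of the basis `e`. It is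
alternating on `⟨e₀, e₁⟩`, so that every line of that plane is its own orthogonal in the plane. -/
noncomputable def form (π : K) (e : Module.Basis (Fin 3) K (Fin 3 → K)) :
    BilinForm K (Fin 3 → K) :=
  Matrix.toBilin e !![0, 1, 0; -1, 0, 0; 0, 0, π⁻¹]

theorem form_apply (π : K) (e : Module.Basis (Fin 3) K (Fin 3 → K)) (x y : Fin 3 → K) :
    form π e x y = e.repr x 0 * e.repr y 1 - e.repr x 1 * e.repr y 0
      + π⁻¹ * (e.repr x 2 * e.repr y 2) := by
  simp only [form, Matrix.toBilin_apply, Fin.sum_univ_three]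
  simp
  ring

theorem form_nondegenerate {π : K} (hπ : π ≠ 0) (e : Module.Basis (Fin 3) K (Fin 3 → K)) :
    (form π e).Nondegenerate := by
  rw [form, Matrix.nondegenerate_toBilin_iff, Matrix.nondegenerate_iff_det_ne_zero,
    Matrix.det_fin_three]
  simpa using hπ

theorem map_det_le_one {a b c d : K} (ha : ν a ≤ 1) (hb : ν b ≤ 1) (hc : ν c ≤ 1) (hd : ν d ≤ 1) :
    ν (a * b - c * d) ≤ 1 := by
  refine ν.map_sub_le ?_ ?_ <;> rw [map_mul] <;> exact mul_le_one' ‹_› ‹_›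

theorem map_inv_mul_le_iff {π : K} (hπ : π ≠ 0) (u : K) : ν (π⁻¹ * u) ≤ 1 ↔ ν u ≤ ν π := by
  rw [map_mul, map_inv₀, inv_mul_le_iff₀ (zero_lt_iff.2 (ν.ne_zero_iff.2 hπ)), mul_one]

section

variable {π : K} {e : Module.Basis (Fin 3) K (Fin 3 → K)} {L M : Lattice ν}

/-- For adapted bases the form is chosen so that duality swaps the two lattices. -/
theorem IsAdapted.dual_left (hπ : π ≠ 0) (h : IsAdapted π e L M) :
    dual (form π e) (form_nondegenerate hπ e) L = M := by
  refine Subtype.ext (Submodule.ext fun x => ?_)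
  rw [mem_dual, h.mem_right]
  constructor
  · intro H
    have h0 := H (e 1) ((h.mem_left _).2 (by simp))
    have h1 := H (e 0) ((h.mem_left _).2 (by simp))
    have h2 := H (e 2) ((h.mem_left _).2 (by simp))
    simp only [form_apply] at h0 h1 h2
    refine ⟨by simpa using h0, by simpa using h1, ?_⟩
    rw [← map_inv_mul_le_iff hπ]
    simpa [-map_mul] using h2
  · rintro ⟨x0, x1, x2⟩ y hy
    obtain ⟨y0, y1, y2⟩ := (h.mem_left _).1 hy
    rw [form_apply]
    refine ν.map_add_le (map_det_le_one x0 y1 x1 y0) ?_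
    rw [map_inv_mul_le_iff hπ, map_mul]
    exact mul_le_of_le_of_le_one x2 y2

theorem IsAdapted.dual_right (hπ : π ≠ 0) (h : IsAdapted π e L M) :
    dual (form π e) (form_nondegenerate hπ e) M = L := by
  refine Subtype.ext (Submodule.ext fun x => ?_)
  rw [mem_dual, h.mem_left]
  constructor
  · intro H
    have h0 := H (e 1) ((h.mem_right _).2 (by simp))
    have h1 := H (e 0) ((h.mem_right _).2 (by simp))
    have h2 := H (π • e 2) ((h.mem_right _).2 (by simp))
    simp only [form_apply] at h0 h1 h2
    refine ⟨by simpa using h0, by simpa using h1, ?_⟩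
    have e2 : π⁻¹ * (e.repr x 2 * π) = e.repr x 2 := by field_simp
    simpa [-map_mul, e2] using h2
  · rintro ⟨x0, x1, x2⟩ y hy
    obtain ⟨y0, y1, y2⟩ := (h.mem_right _).1 hy
    rw [form_apply]
    refine ν.map_add_le (map_det_le_one x0 y1 x1 y0) ?_
    rw [map_inv_mul_le_iff hπ, map_mul]
    exact mul_le_of_le_one_of_le x2 y2

variable [ν.IsRankOneDiscrete]

/-- No lattice lies strictly between `M = ⟨e₀, e₁, π e₂⟩` and `L = ⟨e₀, e₁, e₂⟩`. -/
theorem IsAdapted.eq_or_eq (hπ : ν.IsUniformizer π) (h : IsAdapted π e L M) {Z : Lattice ν}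
    (h1 : M.1 ≤ Z.1) (h2 : Z.1 ≤ L.1) : Z = M ∨ Z = L := by
  by_cases hz : ∀ z ∈ Z.1, ν (e.repr z 2) ≤ ν π
  · refine Or.inl (Subtype.ext (le_antisymm (fun z hzZ => ?_) h1))
    obtain ⟨z0, z1, -⟩ := (h.mem_left z).1 (h2 hzZ)
    exact (h.mem_right z).2 ⟨z0, z1, hz z hzZ⟩
  · refine Or.inr (Subtype.ext (le_antisymm h2 fun x hx => ?_))
    push Not at hz
    obtain ⟨z, hzZ, hz⟩ := hz
    obtain ⟨z0, z1, z2⟩ := (h.mem_left z).1 (h2 hzZ)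
    obtain ⟨x0, x1, x2⟩ := (h.mem_left x).1 hx
    have hz2 : ν (e.repr z 2) = 1 :=
      z2.eq_or_lt.resolve_right fun hlt => absurd (le_of_lt_one hπ hlt) (not_le.2 hz)
    have hz0 : e.repr z 2 ≠ 0 := ν.ne_zero_iff.1 (by simp [hz2])
    set t := e.repr x 2 / e.repr z 2 with ht
    have ht1 : ν t ≤ 1 := by rw [ht, map_div₀, hz2, div_one]; exact x2
    -- Subtracting a multiple of `z` kills the last coordinate of `x`, which then lies in `M`.
    have hd : x - t • z ∈ M.1 := by
      rw [h.mem_right]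
      simp only [map_sub, map_smul, Finsupp.sub_apply, Finsupp.smul_apply, smul_eq_mul]
      refine ⟨ν.map_sub_le x0 ?_, ν.map_sub_le x1 ?_, ?_⟩
      · rw [map_mul]; exact mul_le_one' ht1 z0
      · rw [map_mul]; exact mul_le_one' ht1 z1
      · rw [ht, div_mul_cancel₀ _ hz0, sub_self, map_zero]; exact zero_le
    have := Z.1.add_mem (h1 hd) (smul_mem_of_le_one ht1 Z.1 hzZ)
    simpa using this

/-- A lattice strictly between `π L` and `M` is, up to homothety, its own dual. -/
theorem IsAdapted.dual_of_between (hπ : ν.IsUniformizer π) (h : IsAdapted π e L M) {Z : Lattice ν}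
    (h1 : π • L.1 ≤ Z.1) (h2 : Z.1 ≤ M.1) (hL : Z.1 ≠ π • L.1) (hM : Z.1 ≠ M.1) :
    (dual (form π e) (form_nondegenerate hπ.ne_zero e) Z).1 = π⁻¹ • Z.1 := by
  have hL' : ∀ x, x ∈ π • L.1 ↔
      ν (e.repr x 0) ≤ ν π ∧ ν (e.repr x 1) ≤ ν π ∧ ν (e.repr x 2) ≤ ν π := fun x => by
    rw [mem_smul_iff hπ.ne_zero, h.mem_left]
    simp only [map_smul, Finsupp.smul_apply, smul_eq_mul, map_inv_mul_le_iff hπ.ne_zero]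
  -- The minors of pairs of elements of `Z` are divisible by `π`, since otherwise `Z = M`.
  have hdet : ∀ x ∈ Z.1, ∀ y ∈ Z.1,
      ν (e.repr x 0 * e.repr y 1 - e.repr x 1 * e.repr y 0) ≤ ν π := by
    intro x hx y hy
    by_contra hlt
    apply hM
    refine le_antisymm h2 fun m hm => ?_
    obtain ⟨x0, x1, x2⟩ := (h.mem_right x).1 (h2 hx)
    obtain ⟨y0, y1, y2⟩ := (h.mem_right y).1 (h2 hy)
    obtain ⟨m0, m1, m2⟩ := (h.mem_right m).1 hm
    set d := e.repr x 0 * e.repr y 1 - e.repr x 1 * e.repr y 0 with hd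
    have hd1 : ν d = 1 := (map_det_le_one x0 y1 x1 y0).eq_or_lt.resolve_right
      fun h => hlt (le_of_lt_one hπ h)
    have hd0 : d ≠ 0 := ν.ne_zero_iff.1 (by simp [hd1])
    -- Cramer's rule expresses the first two coordinates of `m` by those of `x` and `y`.
    set s := (e.repr m 0 * e.repr y 1 - e.repr m 1 * e.repr y 0) / d with hs
    set t := (e.repr m 1 * e.repr x 0 - e.repr m 0 * e.repr x 1) / d with ht
    have hs1 : ν s ≤ 1 := by
      rw [hs, map_div₀, hd1, div_one]; exact map_det_le_one m0 y1 m1 y0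
    have ht1 : ν t ≤ 1 := by
      rw [ht, map_div₀, hd1, div_one]; exact map_det_le_one m1 x0 m0 x1
    have hr : m - (s • x + t • y) ∈ π • L.1 := by
      rw [hL']
      simp only [map_sub, map_add, map_smul, Finsupp.sub_apply, Finsupp.add_apply,
        Finsupp.smul_apply, smul_eq_mul]
      refine ⟨?_, ?_, ν.map_sub_le m2 (ν.map_add_le ?_ ?_)⟩
      · have : e.repr m 0 - (s * e.repr x 0 + t * e.repr y 0) = 0 := by
          rw [hs, ht]; field_simp; rw [hd]; ring
        rw [this, map_zero]; exact zero_le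
      · have : e.repr m 1 - (s * e.repr x 1 + t * e.repr y 1) = 0 := by
          rw [hs, ht]; field_simp; rw [hd]; ring
        rw [this, map_zero]; exact zero_le
      · rw [map_mul]; exact mul_le_of_le_one_of_le hs1 x2
      · rw [map_mul]; exact mul_le_of_le_one_of_le ht1 y2
    have := Z.1.add_mem (h1 hr)
      (Z.1.add_mem (smul_mem_of_le_one hs1 Z.1 hx) (smul_mem_of_le_one ht1 Z.1 hy))
    simpa using this
  ext x
  rw [mem_smul_iff (inv_ne_zero hπ.ne_zero), inv_inv]
  constructor
  · intro hx
    have hxπ : π • x ∈ M.1 := by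
      have h3 := dual_anti _ (form_nondegenerate hπ.ne_zero e)
        (L := scale hπ.ne_zero L) (M := Z) h1
      rw [dual_eq_of_eq_smul _ _ (L := L) (M := scale hπ.ne_zero L) hπ.ne_zero rfl,
        h.dual_left hπ.ne_zero] at h3
      have := h3 hx
      rwa [mem_smul_iff (inv_ne_zero hπ.ne_zero), inv_inv] at this
    rw [mem_dual] at hx
    obtain ⟨z, hz, hzL⟩ : ∃ z ∈ Z.1, z ∉ π • L.1 := by
      by_contra! hcon
      exact hL (le_antisymm hcon h1)
    obtain ⟨z0, z1, z2⟩ := (h.mem_right z).1 (h2 hz)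
    have hB : ν (e.repr (π • x) 0 * e.repr z 1 - e.repr (π • x) 1 * e.repr z 0) ≤ ν π := by
      obtain ⟨-, -, w2⟩ := (h.mem_right _).1 hxπ
      have hB := hx z hz
      rw [form_apply] at hB
      have e1 : e.repr (π • x) 0 * e.repr z 1 - e.repr (π • x) 1 * e.repr z 0 =
          π * ((e.repr x 0 * e.repr z 1 - e.repr x 1 * e.repr z 0
            + π⁻¹ * (e.repr x 2 * e.repr z 2)) - π⁻¹ * (e.repr x 2 * e.repr z 2)) := by
        simp only [map_smul, Finsupp.smul_apply, smul_eq_mul]; ring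
      rw [e1, map_mul]
      refine mul_le_of_le_one_right' (ν.map_sub_le hB ?_)
      rw [map_inv_mul_le_iff hπ.ne_zero, map_mul]
      refine mul_le_of_le_one_of_le ?_ z2
      simp only [map_smul, Finsupp.smul_apply, smul_eq_mul, map_mul] at w2
      exact le_of_mul_le_mul_left (w2.trans_eq (mul_one _).symm)
        (zero_lt_iff.2 hπ.val_ne_zero)
    obtain ⟨w0, w1, w2⟩ := (h.mem_right _).1 hxπ
    generalize π • x = w at hB w0 w1 w2 ⊢
    -- One of the first two coordinates of `z` is a unit, and `w` is a multiple of `z` modulo `π L`.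
    suffices ∃ t : K, ν t ≤ 1 ∧ ν (e.repr w 0 - t * e.repr z 0) ≤ ν π ∧
        ν (e.repr w 1 - t * e.repr z 1) ≤ ν π by
      obtain ⟨t, ht, hw0, hw1⟩ := this
      have hr : w - t • z ∈ π • L.1 := by
        rw [hL']
        simp only [map_sub, map_smul, Finsupp.sub_apply, Finsupp.smul_apply, smul_eq_mul]
        refine ⟨hw0, hw1, ν.map_sub_le w2 ?_⟩
        rw [map_mul]; exact mul_le_of_le_one_of_le ht z2
      have := Z.1.add_mem (h1 hr) (smul_mem_of_le_one ht Z.1 hz)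
      simpa using this
    have hunit : ν (e.repr z 0) = 1 ∨ ν (e.repr z 1) = 1 := by
      by_contra! hne
      exact hzL ((hL' z).2 ⟨le_of_lt_one hπ (lt_of_le_of_ne z0 hne.1),
        le_of_lt_one hπ (lt_of_le_of_ne z1 hne.2), z2⟩)
    rcases hunit with hu | hu
    · have hu0 : e.repr z 0 ≠ 0 := ν.ne_zero_iff.1 (by simp [hu])
      refine ⟨e.repr w 0 / e.repr z 0, by rwa [map_div₀, hu, div_one], ?_, ?_⟩
      · rw [div_mul_cancel₀ _ hu0, sub_self, map_zero]; exact zero_le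
      · rw [show e.repr w 1 - e.repr w 0 / e.repr z 0 * e.repr z 1 =
          -((e.repr w 0 * e.repr z 1 - e.repr w 1 * e.repr z 0) / e.repr z 0) by
            field_simp; ring, ν.map_neg, map_div₀, hu, div_one]
        exact hB
    · have hu0 : e.repr z 1 ≠ 0 := ν.ne_zero_iff.1 (by simp [hu])
      refine ⟨e.repr w 1 / e.repr z 1, by rwa [map_div₀, hu, div_one], ?_, ?_⟩
      · rw [show e.repr w 0 - e.repr w 1 / e.repr z 1 * e.repr z 0 =
          (e.repr w 0 * e.repr z 1 - e.repr w 1 * e.repr z 0) / e.repr z 1 by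
            field_simp, map_div₀, hu, div_one]
        exact hB
      · rw [div_mul_cancel₀ _ hu0, sub_self, map_zero]; exact zero_le
  · intro hx
    rw [mem_dual]
    intro y hy
    obtain ⟨-, -, x2⟩ := (h.mem_right _).1 (h2 hx)
    obtain ⟨-, -, y2⟩ := (h.mem_right _).1 (h2 hy)
    have hd := hdet _ hx y hy
    rw [form_apply]
    simp only [map_smul, Finsupp.smul_apply, smul_eq_mul] at hd x2
    refine ν.map_add_le ?_ ?_
    · rw [← map_inv_mul_le_iff hπ.ne_zero] at hd
      convert hd using 2
      have := hπ.ne_zero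
      field_simp
    · rw [map_inv_mul_le_iff hπ.ne_zero, map_mul]
      refine mul_le_of_le_one_of_le ?_ y2
      rw [map_mul] at x2
      exact le_of_mul_le_mul_left (x2.trans_eq (mul_one _).symm) (zero_lt_iff.2 hπ.val_ne_zero)

/-- A vertex incident to the class of `L` is the class of a lattice between `π L` and `L`, for any
choice of the uniformizer `π`. -/
theorem Incident.exists_between (hπ : ν.IsUniformizer π) {z : Vertex ν}
    (h : Incident ν (Quotient.mk _ L) z) :
    ∃ Z : Lattice ν, Quotient.mk _ Z = z ∧ π • L.1 ≤ Z.1 ∧ Z.1 ≤ L.1 := by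
  obtain ⟨L₁, Z₁, hL, rfl, ϖ, hϖ, h1, h2⟩ := h
  obtain ⟨c, hc, hL⟩ := Quotient.exact hL
  refine ⟨scale hc Z₁, mk_scale _ _, ?_, ?_⟩
  · rw [smul_eq_smul_of_eq hπ.ne_zero (hπ.val.trans hϖ.val.symm), hL, smul_comm]
    exact smul_mono c h1
  · rw [hL]
    exact smul_mono c h2

/-- A vertex incident to the classes of both `L` and `M` is one of them or the class of a lattice
between `π L` and `M`. -/
theorem IsAdapted.exists_between (hπ : ν.IsUniformizer π) (h : IsAdapted π e L M) {z : Vertex ν}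
    (hzL : Incident ν (Quotient.mk _ L) z) (hzM : Incident ν (Quotient.mk _ M) z)
    (hL : z ≠ Quotient.mk _ L) (hM : z ≠ Quotient.mk _ M) :
    ∃ Z : Lattice ν, Quotient.mk _ Z = z ∧ π • L.1 ≤ Z.1 ∧ Z.1 ≤ M.1 := by
  obtain ⟨Z, rfl, h1, h2⟩ := hzL.exists_between hπ
  obtain ⟨Z', hZ', h3, h4⟩ := hzM.exists_between hπ
  obtain ⟨c, hc, hZ⟩ := Quotient.exact hZ'
  -- Here `Z = c Z'`, and the value of `c` has to be `1`.
  have hML : M.1 ≤ L.1 := fun x hx => by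
    obtain ⟨x0, x1, x2⟩ := (h.mem_right x).1 hx
    exact (h.mem_left x).2 ⟨x0, x1, x2.trans hπ.val_lt_one.le⟩
  have hLM : π • L.1 ≤ M.1 := fun x hx => by
    rw [mem_smul_iff hπ.ne_zero, h.mem_left] at hx
    simp only [map_smul, Finsupp.smul_apply, smul_eq_mul, map_inv_mul_le_iff hπ.ne_zero] at hx
    exact (h.mem_right x).2 ⟨hx.1.trans hπ.val_lt_one.le, hx.2.1.trans hπ.val_lt_one.le, hx.2.2⟩
  have hZL : Z.1 ≠ L.1 := fun e => hL (congrArg _ (Subtype.ext e))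
  have hZπL : Z.1 ≠ π • L.1 := fun e =>
    hL ((congrArg _ (Subtype.ext e : Z = scale hπ.ne_zero L)).trans (mk_scale _ _))
  rcases lt_trichotomy (ν c) 1 with hlt | heq | hgt
  · -- If `ν c < 1`, then `Z ⊆ c L ⊆ π L`.
    exfalso
    refine hZπL (le_antisymm ?_ h1)
    rw [hZ]
    exact (smul_mono c (h4.trans hML)).trans
      (smul_le_smul_of_le hπ.ne_zero (le_of_lt_one hπ hlt) L.1)
  · refine ⟨Z, rfl, h1, ?_⟩
    rw [hZ, smul_eq_smul_of_eq hc (heq.trans (map_one ν).symm), one_smul]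
    exact h4
  · -- If `ν c > 1`, then `M ⊆ c π M ⊆ Z ⊆ L`, which leaves only `M` and `L` for `Z`.
    exfalso
    have hinv : ν c⁻¹ ≤ ν π := le_of_lt_one hπ (by
      rwa [map_inv₀, inv_lt_one₀ (zero_lt_one.trans hgt)])
    have hcπ : 1 ≤ ν (c * π) := by
      rw [map_mul]
      rw [map_inv₀, inv_le_iff_one_le_mul₀' (zero_lt_one.trans hgt)] at hinv
      exact hinv
    have h5 : (c * π) • M.1 ≤ Z.1 := by
      rw [mul_smul, hZ]
      exact smul_mono c h3
    have hcπ0 := mul_ne_zero hc hπ.ne_zero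
    have hMZ : M.1 ≤ Z.1 := by
      refine le_trans ?_ h5
      conv_lhs => rw [← one_smul K M.1]
      exact smul_le_smul_of_le hcπ0 (by rwa [map_one]) _
    rcases h.eq_or_eq hπ hMZ h2 with e | e
    · exact hM (congrArg _ e)
    · exact hL (congrArg _ e)

/-- The polarity of `form π e` swaps the classes of `L` and `M` and fixes their common
neighbours. -/
theorem IsAdapted.exists_polarity (hπ : ν.IsUniformizer π) (h : IsAdapted π e L M) :
    ∃ θ : Equiv.Perm (Vertex ν), (∀ a b, Incident ν (θ a) (θ b) ↔ Incident ν a b) ∧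
      θ (Quotient.mk _ L) = Quotient.mk _ M ∧ θ (Quotient.mk _ M) = Quotient.mk _ L ∧
      ∀ z, Incident ν (Quotient.mk _ L) z → Incident ν (Quotient.mk _ M) z →
        z ≠ Quotient.mk _ L → z ≠ Quotient.mk _ M → θ z = z := by
  refine ⟨polarity (form π e) (form_nondegenerate hπ.ne_zero e),
    fun a b => incident_polarity_iff _ _, ?_, ?_, fun z hzL hzM hL hM => ?_⟩
  · rw [polarity_mk, h.dual_left hπ.ne_zero]
  · rw [polarity_mk, h.dual_right hπ.ne_zero]
  · obtain ⟨Z, rfl, h1, h2⟩ := h.exists_between hπ hzL hzM hL hM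
    have hd := h.dual_of_between hπ h1 h2
      (fun e => hL ((congrArg _ (Subtype.ext e : Z = scale hπ.ne_zero L)).trans (mk_scale _ _)))
      (fun e => hM (congrArg _ (Subtype.ext e)))
    rw [polarity_mk]
    refine Quotient.sound ⟨π, hπ.ne_zero, ?_⟩
    rw [hd, smul_smul, mul_inv_cancel₀ hπ.ne_zero, one_smul]

end

/-- Two adjacent vertices of the building are swapped by an automorphism that fixes all their
common neighbours. -/
theorem exists_swap [ν.IsRankOneDiscrete] {x y : Vertex ν} (hxy : Incident ν x y) (hne : x ≠ y) :
    ∃ θ : Equiv.Perm (Vertex ν), (∀ a b, Incident ν (θ a) (θ b) ↔ Incident ν a b) ∧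
      θ x = y ∧ θ y = x ∧
      ∀ z, Incident ν x z → Incident ν y z → z ≠ x → z ≠ y → θ z = z := by
  obtain ⟨L, M, rfl, rfl, π, hπ, h1, h2⟩ := hxy
  obtain ⟨e, h | h⟩ := exists_isAdapted hπ h1 h2
    (fun h => hne (congrArg _ (Subtype.ext h.symm)))
    (fun h => hne ((congrArg _ (Subtype.ext h : M = scale hπ.ne_zero L)).trans
      (mk_scale _ _)).symm)
  · exact h.exists_polarity hπ
  · obtain ⟨θ, hθ, h1, h2, h3⟩ := h.exists_polarity hπ
    rw [mk_scale] at h1 h2 h3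
    exact ⟨θ, hθ, h2, h1, fun z hx hy hzx hzy => h3 z hy hx hzy hzx⟩

theorem map_mem_building_iff [ν.IsRankOneDiscrete] {θ : Equiv.Perm (Vertex ν)}
    (hθ : ∀ a b, Incident ν (θ a) (θ b) ↔ Incident ν a b) (s : Finset (Vertex ν)) :
    s.map θ.toEmbedding ∈ (building ν).faces ↔ s ∈ (building ν).faces := by
  refine and_congr Finset.map_nonempty ?_
  simp only [Finset.forall_mem_map, Equiv.coe_toEmbedding, θ.injective.ne_iff, hθ]

end BruhatTits

namespace SimplicialCx

/-- In a complex isomorphic to the building, two adjacent vertices induce the same group of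
permutations on the common part of their links. -/
theorem inducedGroup_eq_of_isomorphic_building {V K Γ₀ : Type*} [Field K]
    [LinearOrderedCommGroupWithZero Γ₀] (ν : Valuation K Γ₀) [ν.IsRankOneDiscrete]
    (X : AbstractSimplicialComplex V) (hX : Isomorphic X (BruhatTits.building ν)) {v w : V}
    (hwv : w ∈ linkVertices X v) (hvw : v ∈ linkVertices X w) :
    inducedGroup X v ⟨w, hwv⟩ (commonLink X v w) (fun _ h => h.1) =
      inducedGroup X w ⟨v, hvw⟩ (commonLink X v w) (fun _ h => h.2) := by
  obtain ⟨f, hf⟩ := hX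
  have hadj : ∀ {a b}, b ∈ linkVertices X a → BruhatTits.Incident ν (f a) (f b) := by
    rintro a b ⟨hne, s, hs, ha, hb⟩
    exact ((hf s).1 hs).2 _ (Finset.mem_map_of_mem _ ha) _ (Finset.mem_map_of_mem _ hb)
      (f.injective.ne hne.symm)
  obtain ⟨θ, hθ, h1, h2, h3⟩ := BruhatTits.exists_swap (hadj hwv) (f.injective.ne hwv.1.symm)
  refine inducedGroup_eq_of_swap X ((f.trans θ).trans f.symm) (fun s => ?_) (by simp [h1])
    (by simp [h2]) hwv hvw _ _ _ fun x hx => ?_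
  · have e : (s.map ((f.trans θ).trans f.symm).toEmbedding).map f.toEmbedding =
        (s.map f.toEmbedding).map θ.toEmbedding := by
      simp only [Finset.map_map]
      congr 1
      ext
      simp
    rw [hf, hf, e, BruhatTits.map_mem_building_iff hθ]
  · simp [h3 (f x) (hadj hx.1) (hadj hx.2) (f.injective.ne hx.1.1) (f.injective.ne hx.2.1)]

end SimplicialCx

theorem proposition4p4
    {F E : Type*} [Field F] [Finite F] [Field E] [Algebra F E]
    (hE : Module.finrank F E = 3)
    (q : ℕ) (hq : Nat.card F = q)
    (α : Eˣ) (hα : ∀ x : Eˣ, x ∈ Subgroup.zpowers α)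
    (κ : SingerPres.longOrbits q (SingerPres.traceZeroSet F q (α : E)) → ℤˣ)
    {K Γ₀ : Type*} [Field K] [LinearOrderedCommGroupWithZero Γ₀]
    (ν : Valuation K Γ₀) [ν.IsRankOneDiscrete]
    (hΔ : SimplicialCx.Isomorphic
      (TriPres.complex
        (SingerPres.presentation q (SingerPres.traceZeroSet F q (α : E)) κ))
      (BruhatTits.building ν)) :
    TriPres.Q₁ (SingerPres.presentation q (SingerPres.traceZeroSet F q (α : E)) κ) 0 =
      TriPres.Q₀ (SingerPres.presentation q (SingerPres.traceZeroSet F q (α : E)) κ) 0 :=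
  (SimplicialCx.inducedGroup_eq_of_isomorphic_building ν _ hΔ
    (TriPres.inv_gen_mem_link _ 0) (TriPres.one_mem_link _ 0)).symm
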